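/- Theorem 2.1. Let $m\ge 0$, $c>0$, $A>0$, $t_2>t_1>0$ and $a_1,a_2\in\mathbb{R}$, and suppose that $\beta=\frac12-\frac{a_2-a_1}{2c(t_2-t_1)}$ satisfies $0<\beta<1$ (equivalently, $|a_2-a_1|<c(t_2-t_1)$). For $N\ge 1$ put $\varepsilon=\frac{t_2-t_1}{N}$, $x_0=a_1$, $x_N=a_2$, $$G_N=\{(x_1,\dots,x_{N-1})\in\mathbb{R}^{N-1}: |x_{j+1}-x_j|\le \varepsilon c,\ j=0,\dots,N-1\},$$ $$G'_N=\Big\{(y_1,\dots,y_{N-1})\in\mathbb{R}^{N-1}: 0\le y_j\le 1,\ \beta N-1\le \sum_{j=1}^{N-1}y_j\le \beta N\Big\},$$ let $V_{N-1}$ be the $(N-1)$-dimensional Lebesgue volume of $G'_N$ (with $V_0=1$ for $N=1$), and let $$C_N=\frac{A}{(2\varepsilon c)^{N-1}V_{N-1}},\qquad b_N=C_N\int_{G_N}\exp\Big\{mc^2\varepsilon\sum_{j=0}^{N-1}\sqrt{1-\frac{(x_{j+1}-x_j)^2}{c^2\varepsilon^2}}\Big\}\,dx_1\cdots dx_{N-1}.$$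 Then the limit $L=\lim_{N\to\infty}b_N$ exists, and $$A\le L\le A\exp\Big(mc\sqrt{c^2(t_2-t_1)^2-(a_2-a_1)^2}\Big).$$ -/

import Mathlib

open MeasureTheory Filter Topology

noncomputable section

namespace RelBrownian

/-- The time step `ε = (t₂ - t₁) / N`. -/
def step (t₁ t₂ : ℝ) (N : ℕ) : ℝ := (t₂ - t₁) / N

/-- The polygonal path `x₀, x₁, …, x_N` (for `N ≥ 1`) with end points `x₀ = a₁`, `x_N = a₂` and
intermediate nodes `(x₁, …, x_{N-1})`; the node `x_j`, `1 ≤ j ≤ N - 1`, is the coordinate of `x`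
with index `j - 1`. -/
def node (a₁ a₂ : ℝ) (N : ℕ) (x : Fin (N - 1) → ℝ) (j : ℕ) : ℝ :=
  if j = 0 then a₁ else if h : j - 1 < N - 1 then x ⟨j - 1, h⟩ else a₂

/-- `G_N = {(x₁, …, x_{N-1}) ∈ ℝ^{N-1} : |x_{j+1} - x_j| ≤ ε c, j = 0, …, N - 1}`. -/
def pathRegion (c t₁ t₂ a₁ a₂ : ℝ) (N : ℕ) : Set (Fin (N - 1) → ℝ) :=
  {x | ∀ j ∈ Finset.range N,
    |node a₁ a₂ N x (j + 1) - node a₁ a₂ N x j| ≤ step t₁ t₂ N * c}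

/-- `β = 1/2 - (a₂ - a₁) / (2 c (t₂ - t₁))`. -/
def beta (c t₁ t₂ a₁ a₂ : ℝ) : ℝ := 1 / 2 - (a₂ - a₁) / (2 * c * (t₂ - t₁))

/-- `G'_N = {(y₁, …, y_{N-1}) ∈ ℝ^{N-1} : 0 ≤ y_j ≤ 1, β N - 1 ≤ ∑ y_j ≤ β N}`. -/
def cubeRegion (β : ℝ) (N : ℕ) : Set (Fin (N - 1) → ℝ) :=
  {y | (∀ j, 0 ≤ y j ∧ y j ≤ 1) ∧ β * N - 1 ≤ ∑ j, y j ∧ ∑ j, y j ≤ β * N}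

/-- `V_{N-1}`, the Lebesgue volume of `G'_N` in `ℝ^{N-1}`. -/
def cubeVolume (β : ℝ) (N : ℕ) : ℝ := (volume (cubeRegion β N)).toReal

/-- The regularizing factor `C_N = A / ((2 ε c)^{N-1} V_{N-1})`. -/
def regFactor (A c t₁ t₂ a₁ a₂ : ℝ) (N : ℕ) : ℝ :=
  A / ((2 * step t₁ t₂ N * c) ^ (N - 1) * cubeVolume (beta c t₁ t₂ a₁ a₂) N)

/-- The regularized finite-difference approximation of the path integral,
`b_N = C_N ∫_{G_N} exp (m c² ε ∑_{j=0}^{N-1} √(1 - (x_{j+1} - x_j)² / (c² ε²))) dx₁ ⋯ dx_{N-1}`. -/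
def approx (A m c t₁ t₂ a₁ a₂ : ℝ) (N : ℕ) : ℝ :=
  regFactor A c t₁ t₂ a₁ a₂ N *
    ∫ x in pathRegion c t₁ t₂ a₁ a₂ N,
      Real.exp (m * c ^ 2 * step t₁ t₂ N *
        ∑ j ∈ Finset.range N,
          Real.sqrt (1 - (node a₁ a₂ N x (j + 1) - node a₁ a₂ N x j) ^ 2 /
            (c ^ 2 * step t₁ t₂ N ^ 2)))

end RelBrownian

end

/-! Writing the increments as `ε c (1 - 2 y_j)` turns `b_N / A` into the average of `exp (κ · mean
of f(y_j))` over the part of the unit cube where `N` coordinates sum to `β N`. Here `f t = √(1 - (1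
- 2t)²)`, `κ = m c² (t₂ - t₁)`, and the last coordinate is determined by the others (`approx_succ`).

This is Gibbs conditioning. Let `l` be such that the density proportional to `exp (l y)` on `[0, 1]`
has mean `β` (`exists_tilt`), and let `μ` be the mean of `f` under it. Deviations of the empirical
mean of `f` from `μ` are exponentially rare under the tilted product law
(`exists_setIntegral_prod_le_pow`). The conditioning slab has bounded width, so its tilted mass must
be shown to decay subexponentially (`eventually_pow_le_windowVolume`). A law of large numbers puts
the sum within `a n` of its target, and a small proportion of further coordinates steers it into a
bounded window. Hence `L = A exp (κ μ)` (`tendsto_average_exp`). The lower bound is `μ ≥ 0`; the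
upper bound is Jensen's inequality `μ ≤ f β` for the concave `f` (`exists_tilted_mean`). -/

namespace RelBrownian

/-! ### Uniform measure on the unit interval and cube. -/

/-- Lebesgue measure on the unit interval. -/
noncomputable abbrev unitMeasure : Measure ℝ := volume.restrict (Set.Icc 0 1)

/-- Lebesgue measure on the unit cube. -/
noncomputable abbrev cubeMeasure (n : ℕ) : Measure (Fin n → ℝ) :=
  Measure.pi fun _ => unitMeasure

instance : IsProbabilityMeasure unitMeasure := ⟨by simp [unitMeasure]⟩

theorem integrable_unitMeasure {f : ℝ → ℝ} (hf : Continuous f) : Integrable f unitMeasure :=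
  hf.integrableOn_Icc

theorem ae_mem_unitMeasure : ∀ᵐ y ∂unitMeasure, y ∈ Set.Icc (0 : ℝ) 1 :=
  ae_restrict_mem measurableSet_Icc

theorem cubeMeasure_eq_restrict (n : ℕ) :
    cubeMeasure n = volume.restrict (Set.univ.pi fun _ : Fin n => Set.Icc (0 : ℝ) 1) := by
  rw [volume_pi, Measure.restrict_pi_pi]

theorem integral_unitMeasure_pos {f : ℝ → ℝ} (hf : Continuous f) (h0 : ∀ y, 0 ≤ f y)
    {y : ℝ} (hy : y ∈ Set.Icc (0 : ℝ) 1) (hpos : 0 < f y) : 0 < ∫ y, f y ∂unitMeasure := by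
  rw [unitMeasure, integral_Icc_eq_integral_Ioc, ← intervalIntegral.integral_of_le zero_le_one]
  exact intervalIntegral.integral_pos zero_lt_one hf.continuousOn (fun x _ => h0 x) ⟨y, hy, hpos⟩

/-! ### Exponential tilting to a prescribed mean. -/

theorem add_mul_sq_le_mul_exp {s t : ℝ} (hs : 0 ≤ s) :
    t + s * max t 0 ^ 2 ≤ t * Real.exp (s * t) := by
  rcases le_total 0 t with h | h
  · rw [max_eq_left h]
    nlinarith [Real.add_one_le_exp (s * t)]
  · rw [max_eq_right h]
    have : Real.exp (s * t) ≤ 1 := Real.exp_le_one_iff.2 (mul_nonpos_of_nonneg_of_nonpos hs h)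
    nlinarith

/-- The exponential weight with parameter `l`, centred at `β`. -/
noncomputable def tilt (l β y : ℝ) : ℝ := Real.exp (l * (y - β))

theorem tilt_pos (l β y : ℝ) : 0 < tilt l β y := Real.exp_pos _

theorem continuous_tilt (l β : ℝ) : Continuous (tilt l β) := by
  unfold tilt; fun_prop

theorem integral_tilt_pos (l β : ℝ) : 0 < ∫ y, tilt l β y ∂unitMeasure :=
  integral_unitMeasure_pos (continuous_tilt l β) (fun y => (tilt_pos l β y).le)
    (Set.left_mem_Icc.2 zero_le_one) (tilt_pos l β 0)

/-- Some exponential weight has mean `β`. -/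
theorem exists_tilt {β : ℝ} (h0 : 0 < β) (h1 : β < 1) :
    ∃ l, ∫ y, (y - β) * tilt l β y ∂unitMeasure = 0 := by
  have hcont : Continuous fun l => ∫ y, (y - β) * tilt l β y ∂unitMeasure := by
    refine continuous_parametric_integral_of_continuous (f := fun l y => (y - β) * tilt l β y)
      ?_ isCompact_Icc
    unfold tilt
    fun_prop
  set p := ∫ y, max (y - β) 0 ^ 2 ∂unitMeasure with hp
  set q := ∫ y, max (β - y) 0 ^ 2 ∂unitMeasure with hq
  set a := ∫ y, (y - β) ∂unitMeasure with ha
  have hp0 : 0 < p := integral_unitMeasure_pos (by fun_prop) (fun _ => sq_nonneg _)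
    (Set.right_mem_Icc.2 zero_le_one) (by rw [max_eq_left (by linarith)]; nlinarith)
  have hq0 : 0 < q := integral_unitMeasure_pos (by fun_prop) (fun _ => sq_nonneg _)
    (Set.left_mem_Icc.2 zero_le_one) (by rw [max_eq_left (by linarith)]; nlinarith)
  -- The centred moment grows at least linearly in `s`, and symmetrically falls for `-s`. It
  -- therefore takes both signs, and the intermediate value theorem gives a zero.
  have hup : ∀ s, 0 ≤ s → a + s * p ≤ ∫ y, (y - β) * tilt s β y ∂unitMeasure := by
    intro s hs
    rw [ha, hp, ← integral_const_mul, ← integral_add (integrable_unitMeasure (by fun_prop))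
      (integrable_unitMeasure (by fun_prop))]
    refine integral_mono (integrable_unitMeasure (by fun_prop))
      (integrable_unitMeasure (by unfold tilt; fun_prop)) fun y => ?_
    exact add_mul_sq_le_mul_exp hs
  have hdown : ∀ s, 0 ≤ s → ∫ y, (y - β) * tilt (-s) β y ∂unitMeasure ≤ a - s * q := by
    intro s hs
    rw [ha, hq, ← integral_const_mul, ← integral_sub (integrable_unitMeasure (by fun_prop))
      (integrable_unitMeasure (by fun_prop))]
    refine integral_mono (integrable_unitMeasure (by unfold tilt; fun_prop))
      (integrable_unitMeasure (by fun_prop)) fun y => ?_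
    have := add_mul_sq_le_mul_exp (s := s) (t := β - y) hs
    simp only [tilt]
    rw [show -s * (y - β) = s * (β - y) by ring]
    linarith
  exact mem_range_of_exists_le_of_exists_ge hcont (c := 0)
    ⟨-(|a| / q), (hdown _ (by positivity)).trans (by
      rw [div_mul_cancel₀ _ hq0.ne']; linarith [le_abs_self a])⟩
    ⟨|a| / p, le_trans (by rw [div_mul_cancel₀ _ hp0.ne']; linarith [neg_abs_le a])
      (hup _ (by positivity))⟩

/-! ### Chernoff bounds for product weights. -/

theorem exists_integral_exp_mul_lt {w φ : ℝ → ℝ} (hw : Continuous w) (hφ : Continuous φ)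
    (hw0 : ∀ y, 0 < w y) (hneg : ∫ y, φ y * w y ∂unitMeasure < 0) :
    ∃ s, 0 < s ∧ ∫ y, Real.exp (s * φ y) * w y ∂unitMeasure < ∫ y, w y ∂unitMeasure := by
  obtain ⟨B, hB⟩ := isCompact_Icc.exists_bound_of_continuousOn
    (s := Set.Icc (0 : ℝ) 1) hφ.continuousOn
  set D := ∫ y, φ y * w y ∂unitMeasure with hD
  set Z := ∫ y, w y ∂unitMeasure with hZ
  have hB0 : 0 ≤ B := (norm_nonneg _).trans (hB 0 (Set.left_mem_Icc.2 zero_le_one))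
  have hZ0 : 0 < Z := integral_unitMeasure_pos hw (fun y => (hw0 y).le)
    (Set.left_mem_Icc.2 zero_le_one) (hw0 0)
  -- The first condition permits `exp x ≤ 1 + x + x²` at `x = s φ y`; the second makes the quadratic
  -- error `s² B² Z` smaller than the linear gain `-s D`.
  obtain ⟨s, hs0, hs1, hs2⟩ : ∃ s, 0 < s ∧ s * B ≤ 1 ∧ s * (B ^ 2 * Z) < -D := by
    have h1 : ∀ᶠ s in 𝓝[>] (0 : ℝ), s * B < 1 := by
      refine nhdsWithin_le_nhds (ContinuousAt.eventually_lt (by fun_prop) (by fun_prop) (by simp))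
    have h2 : ∀ᶠ s in 𝓝[>] (0 : ℝ), s * (B ^ 2 * Z) < -D := by
      refine nhdsWithin_le_nhds (ContinuousAt.eventually_lt (by fun_prop) (by fun_prop)
        (by simpa using hneg))
    obtain ⟨s, hs1, hs2, hs0⟩ := (h1.and (h2.and self_mem_nhdsWithin)).exists
    exact ⟨s, hs0, hs1.le, hs2⟩
  refine ⟨s, hs0, ?_⟩
  have key : ∫ y, Real.exp (s * φ y) * w y ∂unitMeasure
      ≤ ∫ y, (w y + s * (φ y * w y) + s ^ 2 * B ^ 2 * w y) ∂unitMeasure := by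
    refine integral_mono_ae (integrable_unitMeasure (by fun_prop))
      (integrable_unitMeasure (by fun_prop)) ?_
    filter_upwards [ae_mem_unitMeasure] with y hy
    have hφB : |φ y| ≤ B := hB y hy
    have hle : |s * φ y| ≤ s * B := by
      rw [abs_mul, abs_of_pos hs0]; gcongr
    have he := (abs_le.1 (Real.abs_exp_sub_one_sub_id_le (hle.trans hs1))).2
    have hsq : (s * φ y) ^ 2 ≤ (s * B) ^ 2 :=
      sq_le_sq' (by linarith [(abs_le.1 hle).1]) (abs_le.1 hle).2
    have : Real.exp (s * φ y) ≤ 1 + s * φ y + s ^ 2 * B ^ 2 := by nlinarith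
    nlinarith [hw0 y]
  have hint : ∫ y, (w y + s * (φ y * w y) + s ^ 2 * B ^ 2 * w y) ∂unitMeasure
      = Z + s * D + s ^ 2 * B ^ 2 * Z := by
    rw [integral_add (integrable_unitMeasure (by fun_prop)) (integrable_unitMeasure (by fun_prop)),
      integral_add (integrable_unitMeasure (by fun_prop)) (integrable_unitMeasure (by fun_prop)),
      integral_const_mul, integral_const_mul]
  rw [hint] at key
  nlinarith

theorem integrable_prod_cubeMeasure {w : ℝ → ℝ} (hw : Continuous w) (n : ℕ) :
    Integrable (fun y : Fin n → ℝ => ∏ j, w (y j)) (cubeMeasure n) :=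
  Integrable.fintype_prod fun _ => integrable_unitMeasure hw

/-- Chernoff bound for a product weight on the cube. -/
theorem exists_setIntegral_prod_le_pow {w φ : ℝ → ℝ} (hw : Continuous w) (hφ : Continuous φ)
    (hw0 : ∀ y, 0 < w y) (hneg : ∫ y, φ y * w y ∂unitMeasure < 0) :
    ∃ r, 0 < r ∧ r < ∫ y, w y ∂unitMeasure ∧ ∀ n,
      ∫ y in {y : Fin n → ℝ | 0 ≤ ∑ j, φ (y j)}, ∏ j, w (y j) ∂cubeMeasure n ≤ r ^ n := by
  obtain ⟨s, hs, hlt⟩ := exists_integral_exp_mul_lt hw hφ hw0 hneg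
  refine ⟨_, integral_unitMeasure_pos (by fun_prop)
    (fun y => mul_nonneg (Real.exp_pos _).le (hw0 y).le)
    (Set.left_mem_Icc.2 zero_le_one) (mul_pos (Real.exp_pos _) (hw0 0)), hlt, fun n => ?_⟩
  have hmeas : MeasurableSet {y : Fin n → ℝ | 0 ≤ ∑ j, φ (y j)} :=
    (isClosed_le continuous_const (by fun_prop)).measurableSet
  have hi : Integrable (fun y : Fin n → ℝ => ∏ j, (Real.exp (s * φ (y j)) * w (y j)))
      (cubeMeasure n) :=
    integrable_prod_cubeMeasure (w := fun y => Real.exp (s * φ y) * w y) (by fun_prop) n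
  have heq : ∫ y : Fin n → ℝ, ∏ j, (Real.exp (s * φ (y j)) * w (y j)) ∂cubeMeasure n
      = (∫ y, Real.exp (s * φ y) * w y ∂unitMeasure) ^ n := by
    rw [integral_fintype_prod_eq_pow (fun y => Real.exp (s * φ y) * w y), Fintype.card_fin]
  rw [← heq]
  refine le_trans (setIntegral_mono_on (integrable_prod_cubeMeasure hw n).integrableOn
    hi.integrableOn hmeas fun y hy => ?_) (setIntegral_le_integral hi (Eventually.of_forall fun y =>
      Finset.prod_nonneg fun j _ => mul_nonneg (Real.exp_pos _).le (hw0 _).le))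
  rw [Finset.prod_mul_distrib, ← Real.exp_sum, ← Finset.mul_sum]
  exact le_mul_of_one_le_left (Finset.prod_nonneg fun j _ => (hw0 _).le)
    (Real.one_le_exp (mul_nonneg hs.le hy))

/-! ### Lower bounds for the volume of windows around the mean sum. -/

/-- The volume of the part of the unit cube on which the sum of the coordinates is within `R` of
`β n`. -/
noncomputable def windowVolume (β : ℝ) (n : ℕ) (R : ℝ) : ℝ :=
  (cubeMeasure n).real {y | |∑ j, (y j - β)| ≤ R}

theorem windowVolume_mono (β : ℝ) (n : ℕ) : Monotone (windowVolume β n) := fun R S h =>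
  measureReal_mono fun y (hy : |∑ j, (y j - β)| ≤ R) => hy.trans h

theorem measureReal_cons_cubeMeasure (n : ℕ) (s : Set ℝ) (t : Set (Fin n → ℝ)) :
    (cubeMeasure (n + 1)).real {y | y 0 ∈ s ∧ (fun j : Fin n => y j.succ) ∈ t}
      = unitMeasure.real s * (cubeMeasure n).real t := by
  have h := (measurePreserving_piFinSuccAbove (fun _ : Fin (n + 1) => unitMeasure) 0)
  have h2 := congrArg ENNReal.toReal (h.measure_preimage_equiv (s ×ˢ t))
  rw [Measure.prod_prod, ENNReal.toReal_mul] at h2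
  exact h2

theorem unitMeasure_real_Icc {a b : ℝ} (ha : 0 ≤ a) (hab : a ≤ b) (hb : b ≤ 1) :
    unitMeasure.real (Set.Icc a b) = b - a := by
  rw [unitMeasure, measureReal_restrict_apply measurableSet_Icc,
    Set.inter_eq_left.2 (Set.Icc_subset_Icc ha hb), Real.volume_real_Icc_of_le hab]

/-- Adding one coordinate can move the sum half a window closer to its target, at a fixed cost. -/
theorem mul_windowVolume_le_succ {β d : ℝ} (hd : 0 < d) (hd0 : d ≤ β) (hd1 : d ≤ 1 - β)
    (n : ℕ) (R : ℝ) :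
    d / 2 * windowVolume β n R ≤ windowVolume β (n + 1) (max d (R - d / 2)) := by
  set S : Set (Fin n → ℝ) := {y | |∑ j, (y j - β)| ≤ R}
  set P : Set (Fin n → ℝ) := {y | 0 < ∑ j, (y j - β)}
  have hPm : MeasurableSet P := (isOpen_lt continuous_const (by fun_prop)).measurableSet
  have hSm : MeasurableSet S := (isClosed_le (by fun_prop) continuous_const).measurableSet
  -- A positive deviation is followed by a coordinate in `[β - d, β - d/2]`, any other by one in `[β
  -- + d/2, β + d]`. The deviation moves towards zero by at least `d/2`, and an overshoot is at most
  -- `d`.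
  set E₁ : Set (Fin (n + 1) → ℝ) :=
    {y | y 0 ∈ Set.Icc (β - d) (β - d / 2) ∧ (fun j : Fin n => y j.succ) ∈ S ∩ P}
  set E₂ : Set (Fin (n + 1) → ℝ) :=
    {y | y 0 ∈ Set.Icc (β + d / 2) (β + d) ∧ (fun j : Fin n => y j.succ) ∈ S \ P}
  have h1 : (cubeMeasure (n + 1)).real E₁ = d / 2 * (cubeMeasure n).real (S ∩ P) := by
    rw [measureReal_cons_cubeMeasure, unitMeasure_real_Icc] <;> linarith
  have h2 : (cubeMeasure (n + 1)).real E₂ = d / 2 * (cubeMeasure n).real (S \ P) := by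
    rw [measureReal_cons_cubeMeasure, unitMeasure_real_Icc] <;> linarith
  have hm2 : MeasurableSet E₂ := by
    refine (measurableSet_Icc.preimage (measurable_pi_apply 0)).inter ((hSm.diff hPm).preimage ?_)
    fun_prop
  have hdisj : Disjoint E₁ E₂ := Set.disjoint_left.2 fun y hy1 hy2 => hy2.2.2 hy1.2.2
  have hsub : E₁ ∪ E₂ ⊆ {y | |∑ j, (y j - β)| ≤ max d (R - d / 2)} := by
    rintro y (⟨⟨ha, hb⟩, hS, hP⟩ | ⟨⟨ha, hb⟩, hS, hP⟩)
    · simp only [S, P, Set.mem_ofPred_eq] at hS hP ⊢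
      rw [Fin.sum_univ_succ, abs_le]
      have := abs_le.1 hS
      have h3 := le_max_left d (R - d / 2)
      have h4 := le_max_right d (R - d / 2)
      constructor <;> linarith
    · simp only [S, P, Set.mem_ofPred_eq, not_lt] at hS hP ⊢
      rw [Fin.sum_univ_succ, abs_le]
      have := abs_le.1 hS
      have h3 := le_max_left d (R - d / 2)
      have h4 := le_max_right d (R - d / 2)
      constructor <;> linarith
  calc d / 2 * windowVolume β n R
      = (cubeMeasure (n + 1)).real (E₁ ∪ E₂) := by
        rw [measureReal_union hdisj hm2, h1, h2, ← mul_add,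
          measureReal_inter_add_sdiff hPm]
        rfl
    _ ≤ _ := measureReal_mono hsub

/-- Iterated steering: about `2R/d` extra coordinates shrink a window of radius `R` to radius `d`,
each costing a factor `d/2` in volume. -/
theorem pow_mul_windowVolume_le {β d : ℝ} (hd : 0 < d) (hd0 : d ≤ β) (hd1 : d ≤ 1 - β)
    (n k : ℕ) (R : ℝ) :
    (d / 2) ^ k * windowVolume β n R ≤ windowVolume β (n + k) (max d (R - k * (d / 2))) := by
  induction k with
  | zero =>
    simp only [pow_zero, one_mul, add_zero, Nat.cast_zero, zero_mul, sub_zero]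
    exact windowVolume_mono _ _ (le_max_right _ _)
  | succ k ih =>
    have h := mul_windowVolume_le_succ hd hd0 hd1 (n + k) (max d (R - k * (d / 2)))
    calc (d / 2) ^ (k + 1) * windowVolume β n R
        = d / 2 * ((d / 2) ^ k * windowVolume β n R) := by ring
      _ ≤ d / 2 * windowVolume β (n + k) (max d (R - k * (d / 2))) := by gcongr
      _ ≤ _ := h
      _ ≤ _ := windowVolume_mono _ _ (by
          push_cast
          refine max_le (le_max_left _ _) ?_
          rw [sub_le_iff_le_add]
          refine max_le ?_ ?_
          · linarith [le_max_left d (R - (k + 1) * (d / 2))]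
          · linarith [le_max_right d (R - (k + 1) * (d / 2))])

theorem prod_tilt (l β : ℝ) {n : ℕ} (y : Fin n → ℝ) :
    ∏ j, tilt l β (y j) = Real.exp (l * ∑ j, (y j - β)) := by
  simp only [tilt, ← Real.exp_sum, Finset.mul_sum]

/-- Law of large numbers: most of the tilted mass has sum within `a n` of `β n`. -/
theorem exists_le_windowVolume {l β a : ℝ} (hl : ∫ y, (y - β) * tilt l β y ∂unitMeasure = 0)
    (ha : 0 < a) :
    ∃ r, 0 < r ∧ r < ∫ y, tilt l β y ∂unitMeasure ∧ ∀ n : ℕ,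
      Real.exp (-(|l| * (a * n))) * ((∫ y, tilt l β y ∂unitMeasure) ^ n - 2 * r ^ n)
        ≤ windowVolume β n (a * n) := by
  set Z := ∫ y, tilt l β y ∂unitMeasure with hZ
  have hZ0 : 0 < Z := integral_tilt_pos l β
  have hw := continuous_tilt l β
  -- Since the tilted mean is `β`, each of the two functions `±(y - β) - a` has weighted integral
  -- `-a Z < 0`, so both tails are exponentially small relative to `Z ^ n`.
  obtain ⟨r₁, hr₁, hr₁Z, H₁⟩ := exists_setIntegral_prod_le_pow (φ := fun y => (y - β) - a) hw
    (by fun_prop) (tilt_pos l β) (by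
      simp only [sub_mul _ a]
      rw [integral_sub (integrable_unitMeasure (by fun_prop))
        (integrable_unitMeasure (by fun_prop)), hl, integral_const_mul]
      nlinarith)
  obtain ⟨r₂, hr₂, hr₂Z, H₂⟩ := exists_setIntegral_prod_le_pow (φ := fun y => -(y - β) - a) hw
    (by fun_prop) (tilt_pos l β) (by
      simp only [sub_mul _ a, neg_mul]
      rw [integral_sub (integrable_unitMeasure (by fun_prop))
        (integrable_unitMeasure (by fun_prop)), integral_neg, hl, integral_const_mul]
      nlinarith)
  refine ⟨max r₁ r₂, lt_max_of_lt_left hr₁, max_lt hr₁Z hr₂Z, fun n => ?_⟩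
  set W : Set (Fin n → ℝ) := {y | |∑ j, (y j - β)| ≤ a * n}
  set E₁ : Set (Fin n → ℝ) := {y | 0 ≤ ∑ j, ((y j - β) - a)}
  set E₂ : Set (Fin n → ℝ) := {y | 0 ≤ ∑ j, (-(y j - β) - a)}
  have hWm : MeasurableSet W := (isClosed_le (by fun_prop) continuous_const).measurableSet
  have hi := integrable_prod_cubeMeasure hw n
  have hnn : ∀ y : Fin n → ℝ, 0 ≤ ∏ j, tilt l β (y j) :=
    fun y => Finset.prod_nonneg fun j _ => (tilt_pos l β _).le
  have htot : ∫ y : Fin n → ℝ, ∏ j, tilt l β (y j) ∂cubeMeasure n = Z ^ n := by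
    rw [integral_fintype_prod_eq_pow (tilt l β), Fintype.card_fin]
  have hcompl : Wᶜ ⊆ E₁ ∪ E₂ := by
    intro y hy
    simp only [W, Set.mem_compl_iff, Set.mem_ofPred_eq, not_le, lt_abs] at hy
    simp only [E₁, E₂, Set.mem_union, Set.mem_ofPred_eq, Finset.sum_sub_distrib (s := Finset.univ)
      (g := fun _ => a), Finset.sum_const, Finset.card_univ, Fintype.card_fin, nsmul_eq_mul,
      Finset.sum_neg_distrib]
    rcases hy with h | h
    · left; linarith
    · right; linarith
  have hbad : ∫ y in Wᶜ, ∏ j, tilt l β (y j) ∂cubeMeasure n ≤ 2 * max r₁ r₂ ^ n := by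
    have h1 : r₁ ^ n ≤ max r₁ r₂ ^ n := by gcongr; exact le_max_left _ _
    have h2 : r₂ ^ n ≤ max r₁ r₂ ^ n := by gcongr; exact le_max_right _ _
    have hm : MeasurableSet E₂ := (isClosed_le continuous_const (by fun_prop)).measurableSet
    have hm1 : MeasurableSet E₁ := (isClosed_le continuous_const (by fun_prop)).measurableSet
    calc ∫ y in Wᶜ, ∏ j, tilt l β (y j) ∂cubeMeasure n
        ≤ ∫ y in E₁ ∪ E₂, ∏ j, tilt l β (y j) ∂cubeMeasure n :=
          setIntegral_mono_set hi.integrableOn (Eventually.of_forall hnn) hcompl.eventuallyLE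
      _ ≤ ∫ y in E₁, ∏ j, tilt l β (y j) ∂cubeMeasure n
          + ∫ y in E₂, ∏ j, tilt l β (y j) ∂cubeMeasure n := by
          rw [← Set.union_sdiff_self, setIntegral_union Set.disjoint_sdiff_right (hm.diff hm1)
            hi.integrableOn hi.integrableOn]
          refine add_le_add le_rfl ?_
          exact setIntegral_mono_set hi.integrableOn (Eventually.of_forall hnn)
            Set.sdiff_subset.eventuallyLE
      _ ≤ r₁ ^ n + r₂ ^ n := add_le_add (H₁ n) (H₂ n)
      _ ≤ _ := by linarith
  have hgood : Z ^ n - 2 * max r₁ r₂ ^ n ≤ ∫ y in W, ∏ j, tilt l β (y j) ∂cubeMeasure n := by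
    have := integral_add_compl hWm hi
    linarith
  -- On the window the weight is at most `exp (|l| a n)`; this converts tilted mass into volume.
  have hW : ∫ y in W, ∏ j, tilt l β (y j) ∂cubeMeasure n
      ≤ Real.exp (|l| * (a * n)) * windowVolume β n (a * n) := by
    have h := setIntegral_mono_on (g := fun _ => Real.exp (|l| * (a * n)))
      hi.integrableOn (integrable_const _).integrableOn hWm fun y hy => by
        rw [prod_tilt]
        refine Real.exp_le_exp.2 ?_
        calc l * ∑ j, (y j - β) ≤ |l * ∑ j, (y j - β)| := le_abs_self _
          _ = |l| * |∑ j, (y j - β)| := abs_mul _ _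
          _ ≤ _ := by gcongr; exact hy
    refine h.trans (le_of_eq ?_)
    rw [setIntegral_const, smul_eq_mul, mul_comm]
    rfl
  rw [Real.exp_neg, inv_mul_le_iff₀ (Real.exp_pos _)]
  exact hgood.trans hW

/-- The window around the mean has the exponential growth rate of the tilted partition function. -/
theorem eventually_pow_le_windowVolume {l β d r : ℝ} (hd : 0 < d) (hd0 : d ≤ β) (hd1 : d ≤ 1 - β)
    (hl : ∫ y, (y - β) * tilt l β y ∂unitMeasure = 0) (hr : 0 < r)
    (hrZ : r < ∫ y, tilt l β y ∂unitMeasure) :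
    ∀ᶠ n : ℕ in atTop, r ^ n / 2 ≤ windowVolume β n d := by
  set Z := ∫ y, tilt l β y ∂unitMeasure with hZ
  have hZ0 : 0 < Z := hr.trans hrZ
  -- `K` bounds the exponential loss per steered coordinate, which contributes `d/2` in place of
  -- `Z`.
  set K := |Real.log (d / (2 * Z))| with hK
  have hKe : Real.exp (-K) ≤ d / (2 * Z) := by
    rw [← Real.le_log_iff_exp_le (by positivity)]
    exact neg_abs_le _
  -- `θ` is the proportion of steered coordinates, small enough that steering and untilting together
  -- keep the rate above `r`.
  obtain ⟨θ, hθ0, hθ1, hθ⟩ : ∃ θ, 0 < θ ∧ θ < 1 ∧ r < Real.exp (-(θ * (K + |l| * (d / 2)))) * Z := by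
    have h1 : ∀ᶠ θ in 𝓝[>] (0 : ℝ), θ < 1 :=
      nhdsWithin_le_nhds (eventually_lt_nhds zero_lt_one)
    have h2 : ∀ᶠ θ in 𝓝[>] (0 : ℝ), r < Real.exp (-(θ * (K + |l| * (d / 2)))) * Z :=
      nhdsWithin_le_nhds (ContinuousAt.eventually_lt (by fun_prop) (by fun_prop) (by simpa))
    obtain ⟨θ, a, b, c⟩ := (h1.and (h2.and self_mem_nhdsWithin)).exists
    exact ⟨θ, c, a, b⟩
  -- With this `a`, about `θ N` steps of size `d/2` absorb the whole window `a n`.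
  set a := θ * (d / 2) with ha
  have ha0 : 0 < a := by positivity
  obtain ⟨ρ, hρ, hρZ, H⟩ := exists_le_windowVolume hl ha0
  have hev : ∀ᶠ n : ℕ in atTop, 2 * ρ ^ n ≤ Z ^ n / 2 := by
    have := tendsto_pow_atTop_nhds_zero_of_lt_one (r := ρ / Z) (by positivity)
      ((div_lt_one hZ0).2 hρZ)
    filter_upwards [this.eventually_lt_const (show (0 : ℝ) < 1 / 4 by norm_num)] with n hn
    rw [div_pow, div_lt_iff₀ (by positivity)] at hn
    linarith
  obtain ⟨n₀, hn₀⟩ := eventually_atTop.1 hev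
  have hlarge : ∀ᶠ N : ℕ in atTop, (n₀ : ℝ) ≤ (1 - θ) * N :=
    (tendsto_natCast_atTop_atTop.const_mul_atTop (by linarith)).eventually_ge_atTop _
  filter_upwards [hlarge] with N hN
  have hN0 : (0 : ℝ) ≤ N := N.cast_nonneg
  obtain ⟨k, hk1, hk2⟩ : ∃ k : ℕ, (k : ℝ) ≤ θ * N ∧ θ * N < k + 1 :=
    ⟨⌊θ * N⌋₊, Nat.floor_le (by positivity), Nat.lt_floor_add_one _⟩
  have hkN : k ≤ N := by
    have : (k : ℝ) ≤ N := by nlinarith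
    exact_mod_cast this
  obtain ⟨n, rfl⟩ : ∃ n, N = n + k := ⟨N - k, by omega⟩
  have hn : n₀ ≤ n := by
    have : (n₀ : ℝ) ≤ n := by push_cast at *; linarith
    exact_mod_cast this
  have hstep := pow_mul_windowVolume_le hd hd0 hd1 n k (a * n)
  have hmax : max d (a * n - k * (d / 2)) = d := by
    apply max_eq_left
    push_cast at hk2
    have hk0 : (0 : ℝ) ≤ k := k.cast_nonneg
    have : θ * n ≤ k + 1 := by nlinarith
    rw [ha]
    nlinarith
  rw [hmax] at hstep
  refine le_trans ?_ hstep
  set T : ℝ := ((n + k : ℕ) : ℝ) with hT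
  have hnT : (n : ℝ) ≤ T := by rw [hT]; push_cast; linarith [(Nat.cast_nonneg k : (0 : ℝ) ≤ k)]
  calc r ^ (n + k) / 2
      ≤ (Real.exp (-(θ * (K + |l| * (d / 2)))) * Z) ^ (n + k) / 2 := by gcongr
    _ = (Real.exp (-K * (θ * T)) * Z ^ k) * (Real.exp (-(|l| * (a * T))) * (Z ^ n / 2)) := by
        rw [mul_pow, ← Real.exp_nat_mul, pow_add Z]
        have : (Real.exp (-K * (θ * T)) * Z ^ k) * (Real.exp (-(|l| * (a * T))) * (Z ^ n / 2))
          = (Real.exp (-K * (θ * T)) * Real.exp (-(|l| * (a * T)))) * (Z ^ n * Z ^ k) / 2 := by ring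
        rw [this, ← Real.exp_add]
        congr 3
        rw [ha, ← hT]
        ring
    _ ≤ (d / 2) ^ k * (Real.exp (-(|l| * (a * n))) * (Z ^ n - 2 * ρ ^ n)) := by
        have e1 : Real.exp (-K * (θ * T)) * Z ^ k ≤ (d / 2) ^ k := by
          have : Real.exp (-K * (θ * T)) ≤ (d / (2 * Z)) ^ k := by
            calc Real.exp (-K * (θ * T)) ≤ Real.exp (k * (-K)) := by
                  refine Real.exp_le_exp.2 ?_
                  have hK0 : 0 ≤ K := abs_nonneg _
                  nlinarith
              _ = Real.exp (-K) ^ k := Real.exp_nat_mul _ _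
              _ ≤ _ := by gcongr
          calc _ ≤ (d / (2 * Z)) ^ k * Z ^ k := by gcongr
            _ = _ := by rw [← mul_pow]; congr 1; field_simp
        have e2 : Real.exp (-(|l| * (a * T))) ≤ Real.exp (-(|l| * (a * n))) := by gcongr
        have e3 : Z ^ n / 2 ≤ Z ^ n - 2 * ρ ^ n := by linarith [hn₀ n hn]
        gcongr
    _ ≤ _ := by gcongr; exact H n

/-! ### Concentration conditionally on the coordinate sum. -/

/-- The points whose coordinate sum can be completed to `β (n + 1)` by one more number in
`[0, 1]`. -/
def sumSlab (β : ℝ) (n : ℕ) : Set (Fin n → ℝ) :=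
  {y | β - 1 ≤ ∑ j, (y j - β) ∧ ∑ j, (y j - β) ≤ β}

theorem isClosed_sumSlab (β : ℝ) (n : ℕ) : IsClosed (sumSlab β n) := by
  have h₁ : IsClosed {y : Fin n → ℝ | β - 1 ≤ ∑ j, (y j - β)} :=
    isClosed_le continuous_const (by fun_prop)
  have h₂ : IsClosed {y : Fin n → ℝ | ∑ j, (y j - β) ≤ β} :=
    isClosed_le (by fun_prop) continuous_const
  exact h₁.inter h₂

theorem windowVolume_le_sumSlab {β d : ℝ} (hd0 : d ≤ β) (hd1 : d ≤ 1 - β) (n : ℕ) :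
    windowVolume β n d ≤ (cubeMeasure n).real (sumSlab β n) := by
  refine measureReal_mono fun y (hy : |∑ j, (y j - β)| ≤ d) => ?_
  have := abs_le.1 hy
  exact ⟨by linarith, by linarith⟩

/-- On the slab `|∑ (y_j - β)| ≤ 1`, so the tilted weight is at least `exp (-|l|)`: passing from
volume to tilted mass costs a constant independent of `n`. -/
theorem measureReal_sumSlab_inter_le {l β : ℝ} (hβ₀ : 0 < β) (hβ₁ : β < 1) {n : ℕ}
    {E : Set (Fin n → ℝ)} (hE : MeasurableSet E) :
    (cubeMeasure n).real (sumSlab β n ∩ E)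
      ≤ Real.exp |l| * ∫ y in E, ∏ j, tilt l β (y j) ∂cubeMeasure n := by
  have hi := integrable_prod_cubeMeasure (continuous_tilt l β) n
  have hm := (isClosed_sumSlab β n).measurableSet.inter hE
  have h1 : (cubeMeasure n).real (sumSlab β n ∩ E) * Real.exp (-|l|)
      ≤ ∫ y in sumSlab β n ∩ E, ∏ j, tilt l β (y j) ∂cubeMeasure n := by
    rw [← smul_eq_mul, ← setIntegral_const]
    refine setIntegral_mono_on (integrable_const _).integrableOn hi.integrableOn hm fun y hy => ?_
    rw [prod_tilt]
    refine Real.exp_le_exp.2 ?_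
    obtain ⟨⟨ha, hb⟩, -⟩ := hy
    have habs : |∑ j, (y j - β)| ≤ 1 := abs_le.2 ⟨by linarith, by linarith⟩
    have := neg_abs_le (l * ∑ j, (y j - β))
    rw [abs_mul] at this
    nlinarith [abs_nonneg l]
  have h2 : ∫ y in sumSlab β n ∩ E, ∏ j, tilt l β (y j) ∂cubeMeasure n
      ≤ ∫ y in E, ∏ j, tilt l β (y j) ∂cubeMeasure n :=
    setIntegral_mono_set hi.integrableOn (Eventually.of_forall fun y =>
      Finset.prod_nonneg fun j _ => (tilt_pos l β _).le) Set.inter_subset_right.eventuallyLE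
  rw [Real.exp_neg, mul_inv_le_iff₀ (Real.exp_pos _)] at h1
  nlinarith [Real.exp_pos |l|]

/-- An event that is exponentially unlikely under the tilted product weight is negligible in the
slab. -/
theorem tendsto_measureReal_sumSlab_inter_div {l β : ℝ} (hβ₀ : 0 < β) (hβ₁ : β < 1)
    (hl : ∫ y, (y - β) * tilt l β y ∂unitMeasure = 0) {φ : ℝ → ℝ} (hφ : Continuous φ)
    (hneg : ∫ y, φ y * tilt l β y ∂unitMeasure < 0) :
    Tendsto (fun n => (cubeMeasure n).real (sumSlab β n ∩ {y | 0 ≤ ∑ j, φ (y j)})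
      / (cubeMeasure n).real (sumSlab β n)) atTop (𝓝 0) := by
  obtain ⟨r, hr, hrZ, H⟩ :=
    exists_setIntegral_prod_le_pow (continuous_tilt l β) hφ (tilt_pos l β) hneg
  -- With `r < r' < Z`, the numerator is `O(r ^ n)` while the slab has volume at least `r' ^ n / 2`.
  obtain ⟨r', hr', hrZ'⟩ := exists_between hrZ
  have hr0 : 0 < r' := hr.trans hr'
  have hlim : Tendsto (fun n : ℕ => 2 * Real.exp |l| * (r / r') ^ n) atTop (𝓝 0) := by
    simpa using (tendsto_pow_atTop_nhds_zero_of_lt_one (r := r / r') (by positivity)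
      ((div_lt_one hr0).2 hr')).const_mul (2 * Real.exp |l|)
  refine squeeze_zero' (Eventually.of_forall fun n => by positivity) ?_ hlim
  filter_upwards [eventually_pow_le_windowVolume (lt_min hβ₀ (sub_pos.2 hβ₁)) (min_le_left _ _)
    (min_le_right _ _) hl hr0 hrZ'] with n hn
  have hV := hn.trans (windowVolume_le_sumSlab (min_le_left _ _) (min_le_right _ _) n)
  have hB := measureReal_sumSlab_inter_le (l := l) hβ₀ hβ₁
    (E := {y : Fin n → ℝ | 0 ≤ ∑ j, φ (y j)})
    (isClosed_le continuous_const (by fun_prop)).measurableSet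
  have hB' := hB.trans (mul_le_mul_of_nonneg_left (H n) (Real.exp_pos |l|).le)
  calc _ ≤ Real.exp |l| * r ^ n / (r' ^ n / 2) := by gcongr
    _ = _ := by rw [div_pow]; field_simp

theorem eventually_sumSlab_pos {β : ℝ} (hβ₀ : 0 < β) (hβ₁ : β < 1) :
    ∀ᶠ n in atTop, 0 < (cubeMeasure n).real (sumSlab β n) := by
  obtain ⟨l, hl⟩ := exists_tilt hβ₀ hβ₁
  have hZ := integral_tilt_pos l β
  filter_upwards [eventually_pow_le_windowVolume (lt_min hβ₀ (sub_pos.2 hβ₁)) (min_le_left _ _)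
    (min_le_right _ _) hl (half_pos hZ) (half_lt_self hZ)] with n hn
  exact lt_of_lt_of_le (by positivity)
    (hn.trans (windowVolume_le_sumSlab (min_le_left _ _) (min_le_right _ _) n))

/-- Conditionally on the coordinate sum, the empirical mean of `f` concentrates at its mean under
the tilted law. -/
theorem tendsto_average_exp {l β κ m : ℝ} (hβ₀ : 0 < β) (hβ₁ : β < 1) (hκ : 0 ≤ κ)
    (hl : ∫ y, (y - β) * tilt l β y ∂unitMeasure = 0) {f : ℝ → ℝ} (hf : Continuous f)
    (hf0 : ∀ y, 0 ≤ f y) (hf1 : ∀ y, f y ≤ 1) (hm0 : 0 ≤ m) (hm1 : m ≤ 1)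
    (hm : ∫ y, (f y - m) * tilt l β y ∂unitMeasure = 0) :
    Tendsto (fun n : ℕ => ((cubeMeasure n).real (sumSlab β n))⁻¹ *
      ∫ y in sumSlab β n, Real.exp (κ / (n + 1) * (∑ j, f (y j) + f (β * (n + 1) - ∑ j, y j)))
        ∂cubeMeasure n) atTop (𝓝 (Real.exp (κ * m))) := by
  have hw := continuous_tilt l β
  have hZ := integral_tilt_pos l β
  rw [Metric.tendsto_atTop']
  suffices H : ∀ ε > 0, ∀ᶠ n : ℕ in atTop, dist (((cubeMeasure n).real (sumSlab β n))⁻¹ *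
      ∫ y in sumSlab β n, Real.exp (κ / (n + 1) * (∑ j, f (y j) + f (β * (n + 1) - ∑ j, y j)))
        ∂cubeMeasure n) (Real.exp (κ * m)) < ε by
    intro ε hε
    obtain ⟨n, hn⟩ := eventually_atTop.1 (H ε hε)
    exact ⟨n, fun k hk => hn k hk.le⟩
  intro ε hε
  have hcont : Continuous fun s => Real.exp (κ * s) := by fun_prop
  obtain ⟨δ, hδ, hδε⟩ := Metric.continuous_iff.1 hcont m (ε / 2) (half_pos hε)
  have hbad₁ := tendsto_measureReal_sumSlab_inter_div hβ₀ hβ₁ hl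
    (φ := fun y => (f y - m) - δ / 2) (by fun_prop) (by
      simp only [sub_mul _ (δ / 2)]
      rw [integral_sub (integrable_unitMeasure (by fun_prop))
        (integrable_unitMeasure (by fun_prop)), hm, integral_const_mul]
      nlinarith)
  have hbad₂ := tendsto_measureReal_sumSlab_inter_div hβ₀ hβ₁ hl
    (φ := fun y => -(f y - m) - δ / 2) (by fun_prop) (by
      simp only [sub_mul _ (δ / 2), neg_mul]
      rw [integral_sub (integrable_unitMeasure (by fun_prop))
        (integrable_unitMeasure (by fun_prop)), integral_neg, hm, integral_const_mul]
      nlinarith)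
  -- The integrand differs from its limit by at most `exp κ` everywhere, so each of the two bad
  -- events contributes less than `ε / 4`.
  have hε4 : 0 < ε / 4 / Real.exp κ := by positivity
  -- The completing coordinate changes the sum of `f` by at most `1`; this is absorbed in the unused
  -- half of `δ`.
  have hlarge : ∀ᶠ n : ℕ in atTop, 1 < δ / 2 * (n + 1 : ℝ) :=
    ((tendsto_natCast_atTop_atTop.atTop_add tendsto_const_nhds).const_mul_atTop
      (half_pos hδ)).eventually_gt_atTop _
  filter_upwards [hlarge, hbad₁.eventually_lt_const hε4, hbad₂.eventually_lt_const hε4,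
    eventually_sumSlab_pos hβ₀ hβ₁] with n hn hb₁ hb₂ hV
  set S := sumSlab β n with hS
  set V := (cubeMeasure n).real S with hVdef
  set E₁ : Set (Fin n → ℝ) := {y | 0 ≤ ∑ j, ((f (y j) - m) - δ / 2)} with hE₁
  set E₂ : Set (Fin n → ℝ) := {y | 0 ≤ ∑ j, (-(f (y j) - m) - δ / 2)} with hE₂
  set h : (Fin n → ℝ) → ℝ := fun y =>
    Real.exp (κ / (n + 1) * (∑ j, f (y j) + f (β * (n + 1) - ∑ j, y j))) with hh
  have hm₁ : MeasurableSet E₁ := (isClosed_le continuous_const (by fun_prop)).measurableSet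
  have hm₂ : MeasurableSet E₂ := (isClosed_le continuous_const (by fun_prop)).measurableSet
  have hn0 : (0 : ℝ) < n + 1 := by positivity
  have hsum0 : ∀ y : Fin n → ℝ, 0 ≤ ∑ j, f (y j) := fun y => Finset.sum_nonneg fun j _ => hf0 _
  have hsum1 : ∀ y : Fin n → ℝ, ∑ j, f (y j) ≤ n := fun y => by
    simpa using Finset.sum_le_sum fun j (_ : j ∈ Finset.univ) => hf1 (y j)
  have hrew : ∀ y, h y = Real.exp (κ * ((∑ j, f (y j) + f (β * (n + 1) - ∑ j, y j)) / (n + 1))) := by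
    intro y; simp only [hh]; congr 1; ring
  have hexp1 : ∀ s, 0 ≤ s → s ≤ 1 → Real.exp (κ * s) ∈ Set.Icc 0 (Real.exp κ) := fun s h0 h1 =>
    ⟨(Real.exp_pos _).le, Real.exp_le_exp.2 (by nlinarith)⟩
  have hmem : ∀ y, h y ∈ Set.Icc 0 (Real.exp κ) := fun y => by
    rw [hrew]
    refine hexp1 _ (div_nonneg (add_nonneg (hsum0 y) (hf0 _)) hn0.le) ?_
    rw [div_le_one hn0]
    exact add_le_add (hsum1 y) (hf1 _)
  have hdiff : ∀ y, |h y - Real.exp (κ * m)| ≤ Real.exp κ := fun y => by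
    have h1 := hmem y
    have h2 := hexp1 m hm0 hm1
    exact abs_le.2 ⟨by linarith [h1.1, h2.2], by linarith [h1.2, h2.1]⟩
  have hpt : ∀ y, |h y - Real.exp (κ * m)| ≤ ε / 2 + E₁.indicator (fun _ => Real.exp κ) y
      + E₂.indicator (fun _ => Real.exp κ) y := by
    intro y
    have i₁ : 0 ≤ E₁.indicator (fun _ => Real.exp κ) y :=
      Set.indicator_nonneg (fun _ _ => (Real.exp_pos κ).le) y
    have i₂ : 0 ≤ E₂.indicator (fun _ => Real.exp κ) y :=
      Set.indicator_nonneg (fun _ _ => (Real.exp_pos κ).le) y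
    by_cases h1 : y ∈ E₁
    · rw [Set.indicator_of_mem h1]; linarith [hdiff y]
    by_cases h2 : y ∈ E₂
    · rw [Set.indicator_of_mem h2]; linarith [hdiff y]
    simp only [hE₁, hE₂, Set.mem_ofPred_eq, not_le, Finset.sum_sub_distrib,
      Finset.sum_neg_distrib, Finset.sum_const, Finset.card_univ, Fintype.card_fin,
      nsmul_eq_mul] at h1 h2
    have hlt : dist ((∑ j, f (y j) + f (β * (n + 1) - ∑ j, y j)) / (n + 1)) m < δ := by
      rw [Real.dist_eq, div_sub' hn0.ne', abs_div, abs_of_pos hn0, div_lt_iff₀ hn0, abs_lt]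
      have a1 := hf0 (β * (n + 1) - ∑ j, y j)
      have a2 := hf1 (β * (n + 1) - ∑ j, y j)
      constructor <;> nlinarith
    have := hδε _ hlt
    rw [← hrew, Real.dist_eq] at this
    linarith
  have hhc : Continuous h := by simp only [hh]; fun_prop
  have hhi : Integrable h (cubeMeasure n) :=
    Integrable.of_bound hhc.aestronglyMeasurable (Real.exp κ) (Eventually.of_forall fun y => by
      rw [Real.norm_of_nonneg (hmem y).1]; exact (hmem y).2)
  have hii : ∀ E : Set (Fin n → ℝ), MeasurableSet E →
      Integrable (E.indicator fun _ => Real.exp κ) (cubeMeasure n) :=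
    fun E hE => (integrable_const _).indicator hE
  have hSm : MeasurableSet S := (isClosed_sumSlab β n).measurableSet
  have hind : ∀ E : Set (Fin n → ℝ), MeasurableSet E →
      ∫ y in S, E.indicator (fun _ => Real.exp κ) y ∂cubeMeasure n
        = (cubeMeasure n).real (S ∩ E) * Real.exp κ := fun E hE => by
    rw [setIntegral_indicator hE, setIntegral_const, smul_eq_mul]
  have hI : |∫ y in S, (h y - Real.exp (κ * m)) ∂cubeMeasure n|
      ≤ V * (ε / 2) + (cubeMeasure n).real (S ∩ E₁) * Real.exp κ
        + (cubeMeasure n).real (S ∩ E₂) * Real.exp κ := by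
    refine (abs_integral_le_integral_abs).trans ?_
    refine (setIntegral_mono_on (hhi.sub (integrable_const _)).abs.integrableOn
      (((integrable_const _).add (hii _ hm₁)).add (hii _ hm₂)).integrableOn hSm
      fun y _ => hpt y).trans (le_of_eq ?_)
    rw [integral_add' ((integrable_const _).add (hii _ hm₁)).integrableOn
      (hii _ hm₂).integrableOn, integral_add' (integrable_const _).integrableOn
      (hii _ hm₁).integrableOn, hind _ hm₁, hind _ hm₂, setIntegral_const, smul_eq_mul]
  have heq : V⁻¹ * ∫ y in S, h y ∂cubeMeasure n - Real.exp (κ * m)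
      = V⁻¹ * ∫ y in S, (h y - Real.exp (κ * m)) ∂cubeMeasure n := by
    rw [integral_sub hhi.integrableOn (integrable_const _).integrableOn, setIntegral_const,
      smul_eq_mul, mul_sub, inv_mul_cancel_left₀ hV.ne']
  rw [Real.dist_eq, heq, abs_mul, abs_of_pos (inv_pos.2 hV), inv_mul_lt_iff₀ hV]
  rw [div_lt_div_iff₀ hV (Real.exp_pos _)] at hb₁ hb₂
  linarith

/-! ### Change of variables from paths to the cube. -/

theorem integral_comp_toLin' {ι : Type*} [Fintype ι] [DecidableEq ι] {M : Matrix ι ι ℝ}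
    (hM : M.det ≠ 0) (F : (ι → ℝ) → ℝ) :
    ∫ y, F (Matrix.toLin' M y) = |M.det|⁻¹ * ∫ x, F x := by
  have hinj : LinearMap.ker (Matrix.toLin' M) = ⊥ := by
    rw [LinearMap.ker_eq_bot, Matrix.toLin'_apply', Matrix.coe_mulVecLin,
      Matrix.mulVec_injective_iff_isUnit, Matrix.isUnit_iff_isUnit_det]
    exact hM.isUnit
  have hemb := (LinearMap.isClosedEmbedding_of_injective hinj).measurableEmbedding
  rw [← hemb.integral_map, Real.map_matrix_volume_pi_eq_smul_volume_pi hM, integral_smul_measure,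
    ENNReal.toReal_ofReal (abs_nonneg _), abs_inv, smul_eq_mul]

/-- The matrix of partial sums, scaled by `a`. -/
def partialSumMatrix (n : ℕ) (a : ℝ) : Matrix (Fin n) (Fin n) ℝ :=
  Matrix.of fun i j => if j ≤ i then a else 0

theorem det_partialSumMatrix (n : ℕ) (a : ℝ) : (partialSumMatrix n a).det = a ^ n := by
  rw [Matrix.det_of_isLowerTriangular]
  · simp [partialSumMatrix]
  · intro i j hij
    have : ¬ j ≤ i := not_le.2 hij
    simp [partialSumMatrix, this]

/-- The coordinates of `y` followed by the number that brings their sum to `s`. -/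
noncomputable def complete {n : ℕ} (s : ℝ) (y : Fin n → ℝ) (k : ℕ) : ℝ :=
  if h : k < n then y ⟨k, h⟩ else s - ∑ j, y j

theorem complete_fin {n : ℕ} (s : ℝ) (y : Fin n → ℝ) (j : Fin n) : complete s y j = y j := by
  simp [complete]

theorem complete_last {n : ℕ} (s : ℝ) (y : Fin n → ℝ) : complete s y n = s - ∑ j, y j := by
  simp [complete]

theorem sum_range_complete {n : ℕ} (s : ℝ) (y : Fin n → ℝ) (F : ℝ → ℝ) :
    ∑ k ∈ Finset.range (n + 1), F (complete s y k) = ∑ j, F (y j) + F (s - ∑ j, y j) := by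
  rw [Finset.sum_range_succ, complete_last, Finset.sum_range]
  simp only [complete_fin]

/-- The value of `s` is immaterial: since `i < n`, the sum never reaches the completing coordinate.
-/
theorem partialSumMatrix_toLin'_apply {n : ℕ} (a s : ℝ) (y : Fin n → ℝ) (i : Fin n) :
    Matrix.toLin' (partialSumMatrix n a) y i
      = a * ∑ k ∈ Finset.range (i + 1), complete s y k := by
  have h : ∀ j : Fin n, (if j ≤ i then a else 0) * y j
      = (fun k : ℕ => if k ≤ i then a * complete s y k else 0) j := by
    intro j
    simp only [Fin.le_def, complete_fin]
    split_ifs <;> simp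
  simp only [Matrix.toLin'_apply, Matrix.mulVec, dotProduct, partialSumMatrix, Matrix.of_apply]
  rw [Finset.sum_congr rfl fun j _ => h j, ← Finset.sum_range
    (fun k : ℕ => if k ≤ i then a * complete s y k else 0), ← Finset.sum_filter, Finset.mul_sum]
  refine Finset.sum_congr ?_ fun _ _ => rfl
  ext k
  simp only [Finset.mem_filter, Finset.mem_range]
  omega

/-- The nodes of the path with increments `h (1 - 2 y_j)`. -/
theorem node_partialSum {n : ℕ} {h s a₁ a₂ : ℝ} (hs : a₂ - a₁ = h * ((n + 1 : ℕ) - 2 * s))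
    (y : Fin n → ℝ) {k : ℕ} (hk : k ≤ n + 1) :
    node a₁ a₂ (n + 1) ((fun i : Fin n => a₁ + h * ((i + 1 : ℕ) : ℝ))
        + Matrix.toLin' (partialSumMatrix n (-(2 * h))) y) k
      = a₁ + h * ((k : ℝ) - 2 * ∑ j ∈ Finset.range k, complete s y j) := by
  rcases Nat.eq_zero_or_pos k with rfl | hk0
  · simp [node]
  obtain ⟨k, rfl⟩ : ∃ j, k = j + 1 := ⟨k - 1, by omega⟩
  rcases Nat.lt_or_ge k n with hkn | hkn
  · have : node a₁ a₂ (n + 1) ((fun i : Fin n => a₁ + h * ((i + 1 : ℕ) : ℝ))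
        + Matrix.toLin' (partialSumMatrix n (-(2 * h))) y) (k + 1)
        = a₁ + h * ((k + 1 : ℕ) : ℝ)
          + Matrix.toLin' (partialSumMatrix n (-(2 * h))) y ⟨k, hkn⟩ := by
      simp [node, hkn]
    rw [this, partialSumMatrix_toLin'_apply _ s]
    ring
  -- Here the node is the fixed end point `a₂`, and `hs` says that the completed increments add up
  -- to `a₂ - a₁`.
  · obtain rfl : k = n := by omega
    have hsum : ∑ j ∈ Finset.range (k + 1), complete s y j = s := by
      rw [sum_range_complete s y fun t => t]; ring
    rw [hsum, ← hs]
    simp [node]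

theorem node_partialSum_sub {n : ℕ} {h s a₁ a₂ : ℝ} (hs : a₂ - a₁ = h * ((n + 1 : ℕ) - 2 * s))
    (y : Fin n → ℝ) {k : ℕ} (hk : k < n + 1) :
    node a₁ a₂ (n + 1) ((fun i : Fin n => a₁ + h * ((i + 1 : ℕ) : ℝ))
        + Matrix.toLin' (partialSumMatrix n (-(2 * h))) y) (k + 1)
      - node a₁ a₂ (n + 1) ((fun i : Fin n => a₁ + h * ((i + 1 : ℕ) : ℝ))
        + Matrix.toLin' (partialSumMatrix n (-(2 * h))) y) k
      = h * (1 - 2 * complete s y k) := by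
  rw [node_partialSum hs y hk, node_partialSum hs y hk.le, Finset.sum_range_succ]
  push_cast
  ring

theorem mem_cubeRegion_succ {β : ℝ} {n : ℕ} {y : Fin n → ℝ} :
    y ∈ cubeRegion β (n + 1) ↔ (∀ j, 0 ≤ y j ∧ y j ≤ 1) ∧
      β * (n + 1 : ℕ) - 1 ≤ ∑ j, y j ∧ ∑ j, y j ≤ β * (n + 1 : ℕ) := Iff.rfl

theorem cubeRegion_succ (β : ℝ) (n : ℕ) :
    cubeRegion β (n + 1) = sumSlab β n ∩ Set.univ.pi fun _ : Fin n => Set.Icc (0 : ℝ) 1 := by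
  ext y
  have : ∑ j : Fin n, (y j - β) = ∑ j : Fin n, y j - n * β := by
    rw [Finset.sum_sub_distrib]; simp
  refine mem_cubeRegion_succ.trans ?_
  push_cast
  constructor
  · rintro ⟨h, h1, h2⟩
    refine ⟨⟨?_, ?_⟩, fun j _ => h j⟩ <;> rw [this] <;> linarith
  · rintro ⟨⟨h1, h2⟩, h⟩
    rw [this] at h1 h2
    exact ⟨fun j => h j (Set.mem_univ _), by linarith, by linarith⟩

theorem cubeVolume_succ (β : ℝ) (n : ℕ) :
    cubeVolume β (n + 1) = (cubeMeasure n).real (sumSlab β n) := by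
  rw [cubeVolume, cubeRegion_succ, cubeMeasure_eq_restrict,
    measureReal_restrict_apply (isClosed_sumSlab β n).measurableSet]
  rfl

theorem setIntegral_cubeRegion_succ (β : ℝ) (n : ℕ) (F : (Fin n → ℝ) → ℝ) :
    ∫ y in cubeRegion β (n + 1), F y = ∫ y in sumSlab β n, F y ∂cubeMeasure n := by
  rw [cubeRegion_succ, cubeMeasure_eq_restrict,
    Measure.restrict_restrict (isClosed_sumSlab β n).measurableSet]
  rfl

/-- The constraint on `∑ y_j` says exactly that the completing coordinate lies in `[0, 1]`, so all
`n + 1` increments satisfy the same condition, as in `pathRegion`. -/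
theorem mem_cubeRegion_succ_iff (β : ℝ) (n : ℕ) (y : Fin n → ℝ) :
    y ∈ cubeRegion β (n + 1)
      ↔ ∀ k ∈ Finset.range (n + 1), |1 - 2 * complete (β * (n + 1 : ℕ)) y k| ≤ 1 := by
  have habs : ∀ t : ℝ, |1 - 2 * t| ≤ 1 ↔ 0 ≤ t ∧ t ≤ 1 := fun t => by
    rw [abs_le]; constructor <;> rintro ⟨h1, h2⟩ <;> constructor <;> linarith
  rw [mem_cubeRegion_succ]
  simp only [habs]
  constructor
  · rintro ⟨h, h1, h2⟩ k hk
    rcases Nat.lt_succ_iff_lt_or_eq.1 (Finset.mem_range.1 hk) with hk | rfl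
    · exact complete_fin _ y ⟨k, hk⟩ ▸ h ⟨k, hk⟩
    · rw [complete_last]
      constructor <;> linarith
  · intro h
    have hl := h n (by simp)
    rw [complete_last] at hl
    refine ⟨fun j => ?_, ?_, ?_⟩
    · rw [← complete_fin (β * (n + 1 : ℕ)) y j]
      exact h j (Finset.mem_range.2 (j.2.trans (Nat.lt_succ_self n)))
    · linarith
    · linarith

theorem continuous_node (a₁ a₂ : ℝ) (N k : ℕ) : Continuous fun x => node a₁ a₂ N x k := by
  unfold node
  split_ifs <;> fun_prop

theorem isClosed_pathRegion (c t₁ t₂ a₁ a₂ : ℝ) (N : ℕ) :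
    IsClosed (pathRegion c t₁ t₂ a₁ a₂ N) := by
  have : pathRegion c t₁ t₂ a₁ a₂ N = ⋂ j ∈ Finset.range N,
      {x | |node a₁ a₂ N x (j + 1) - node a₁ a₂ N x j| ≤ step t₁ t₂ N * c} := by
    ext x; simp [pathRegion]
  rw [this]
  exact isClosed_biInter fun j _ => isClosed_le
    ((continuous_node _ _ _ _).sub (continuous_node _ _ _ _)).abs continuous_const

/-- In the coordinates `y_j`, the approximations are averages over a slab of the unit cube. -/
theorem approx_succ (A m : ℝ) {c t₁ t₂ a₁ a₂ : ℝ} (hc : 0 < c) (ht : t₁ < t₂) (n : ℕ) :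
    approx A m c t₁ t₂ a₁ a₂ (n + 1)
      = A * (((cubeMeasure n).real (sumSlab (beta c t₁ t₂ a₁ a₂) n))⁻¹ *
        ∫ y in sumSlab (beta c t₁ t₂ a₁ a₂) n,
          Real.exp (m * c ^ 2 * (t₂ - t₁) / (n + 1) * (∑ j, Real.sqrt (1 - (1 - 2 * y j) ^ 2)
            + Real.sqrt (1 - (1 - 2 * (beta c t₁ t₂ a₁ a₂ * (n + 1) - ∑ j, y j)) ^ 2)))
          ∂cubeMeasure n) := by
  set β := beta c t₁ t₂ a₁ a₂ with hβ
  set ε := step t₁ t₂ (n + 1) with hε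
  have hT : 0 < t₂ - t₁ := sub_pos.2 ht
  have hn : (0 : ℝ) < (n + 1 : ℕ) := by positivity
  have hε0 : 0 < ε := div_pos hT hn
  have hh : 0 < ε * c := mul_pos hε0 hc
  -- This relation is what determines `β`.
  have hs : a₂ - a₁ = (ε * c) * ((n + 1 : ℕ) - 2 * (β * (n + 1 : ℕ))) := by
    rw [hβ, hε, beta, step]
    field_simp
    ring
  set b : Fin n → ℝ := fun i => a₁ + ε * c * ((i + 1 : ℕ) : ℝ) with hb
  -- The Jacobian `(2 ε c) ^ n` of `y ↦ b + M y` cancels the power in `regFactor`.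
  set M := partialSumMatrix n (-(2 * (ε * c))) with hM
  have hdet : |M.det| = (2 * ε * c) ^ n := by
    rw [hM, det_partialSumMatrix, abs_pow, abs_neg, abs_of_pos (by positivity), ← mul_assoc]
  have hdet0 : M.det ≠ 0 := by
    rw [← abs_pos, hdet]; positivity
  have hsub : ∀ (y : Fin n → ℝ) (k : ℕ), k ∈ Finset.range (n + 1) →
      node a₁ a₂ (n + 1) (b + Matrix.toLin' M y) (k + 1)
        - node a₁ a₂ (n + 1) (b + Matrix.toLin' M y) k
      = (ε * c) * (1 - 2 * complete (β * (n + 1 : ℕ)) y k) := fun y k hk =>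
    node_partialSum_sub hs y (Finset.mem_range.1 hk)
  set g : (Fin n → ℝ) → ℝ := fun x => Real.exp (m * c ^ 2 * ε * ∑ j ∈ Finset.range (n + 1),
    Real.sqrt (1 - (node a₁ a₂ (n + 1) x (j + 1) - node a₁ a₂ (n + 1) x j) ^ 2 /
      (c ^ 2 * ε ^ 2))) with hg
  set G : Set (Fin n → ℝ) := pathRegion c t₁ t₂ a₁ a₂ (n + 1) with hG
  set F : (Fin n → ℝ) → ℝ := fun y =>
    Real.exp (m * c ^ 2 * (t₂ - t₁) / (n + 1) * (∑ j, Real.sqrt (1 - (1 - 2 * y j) ^ 2)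
            + Real.sqrt (1 - (1 - 2 * (β * (n + 1) - ∑ j, y j)) ^ 2))) with hF
  have hmem : ∀ y, b + Matrix.toLin' M y ∈ G ↔ y ∈ cubeRegion β (n + 1) := by
    intro y
    rw [mem_cubeRegion_succ_iff]
    refine forall₂_congr fun k hk => ?_
    rw [hsub y k hk, abs_mul, abs_of_pos hh, ← hε]
    exact mul_le_iff_le_one_right hh
  have hval : ∀ y, g (b + Matrix.toLin' M y) = F y := by
    intro y
    simp only [hg, hF]
    rw [Finset.sum_congr rfl fun k hk => by
      rw [hsub y k hk, show ((ε * c) * (1 - 2 * complete (β * (n + 1 : ℕ)) y k)) ^ 2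
        / (c ^ 2 * ε ^ 2) = (1 - 2 * complete (β * (n + 1 : ℕ)) y k) ^ 2 by field_simp],
      sum_range_complete _ y fun t => Real.sqrt (1 - (1 - 2 * t) ^ 2), hε, step]
    push_cast
    congr 1
    ring
  have hchange : ∫ x in G, g x = (2 * ε * c) ^ n * ∫ y in cubeRegion β (n + 1), F y := by
    have hGm : MeasurableSet G := (isClosed_pathRegion c t₁ t₂ a₁ a₂ (n + 1)).measurableSet
    have hCm : MeasurableSet (cubeRegion β (n + 1)) := by
      rw [cubeRegion_succ]
      exact (isClosed_sumSlab β n).measurableSet.inter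
        (MeasurableSet.univ_pi fun _ => measurableSet_Icc)
    rw [← integral_indicator hGm, ← integral_add_left_eq_self _ b, ← integral_indicator hCm]
    have h := integral_comp_toLin' hdet0 fun x => G.indicator g (b + x)
    have hind : ∀ y, G.indicator g (b + Matrix.toLin' M y)
        = (cubeRegion β (n + 1)).indicator F y := by
      intro y
      by_cases hy : y ∈ cubeRegion β (n + 1)
      · rw [Set.indicator_of_mem hy, Set.indicator_of_mem ((hmem y).2 hy), hval]
      · rw [Set.indicator_of_notMem hy, Set.indicator_of_notMem (mt (hmem y).1 hy)]
    simp only [hind] at h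
    rw [eq_inv_mul_iff_mul_eq₀ (abs_pos.2 hdet0).ne', hdet] at h
    exact h.symm
  have hpow : (2 * ε * c) ^ n ≠ 0 := by positivity
  calc approx A m c t₁ t₂ a₁ a₂ (n + 1)
      = A / ((2 * ε * c) ^ n * cubeVolume β (n + 1)) * ∫ x in G, g x := rfl
    _ = A * ((cubeVolume β (n + 1))⁻¹ * ∫ y in cubeRegion β (n + 1), F y) := by
        rw [hchange, div_eq_mul_inv, mul_inv]
        field_simp
    _ = _ := by rw [cubeVolume_succ, setIntegral_cubeRegion_succ]

/-! ### The tilted mean and its Jensen bound. -/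

theorem sqrt_le_tangent {β t : ℝ} (hβ₀ : 0 < β) (hβ₁ : β < 1) (ht : t ∈ Set.Icc (0 : ℝ) 1) :
    Real.sqrt (1 - (1 - 2 * t) ^ 2)
      ≤ 2 * Real.sqrt (β * (1 - β)) + (1 - 2 * β) / Real.sqrt (β * (1 - β)) * (t - β) := by
  have hp : 0 < β * (1 - β) := mul_pos hβ₀ (sub_pos.2 hβ₁)
  have hr := Real.sqrt_pos.2 hp
  have hsq := Real.sq_sqrt hp.le
  set r := Real.sqrt (β * (1 - β))
  -- As the root on the left is `2 √(t (1 - t))`, the tangent bound at `β` becomes the AM-GM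
  -- inequality for `t (1 - β)` and `(1 - t) β`.
  have heq : 2 * r + (1 - 2 * β) / r * (t - β) = (t * (1 - β) + (1 - t) * β) / r := by
    field_simp
    rw [hsq]; ring
  rw [heq, Real.sqrt_le_iff, div_pow, hsq, le_div_iff₀ hp]
  refine ⟨div_nonneg (add_nonneg (mul_nonneg ht.1 (by linarith))
    (mul_nonneg (by linarith [ht.2]) hβ₀.le)) hr.le, ?_⟩
  nlinarith [sq_nonneg (t * (1 - β) - (1 - t) * β)]

/-- The tilted mean of `√(1 - (1 - 2 y)²)`, with the bounds given by Jensen's inequality. -/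
theorem exists_tilted_mean {l β : ℝ} (hβ₀ : 0 < β) (hβ₁ : β < 1)
    (hl : ∫ y, (y - β) * tilt l β y ∂unitMeasure = 0) :
    ∃ μ, 0 ≤ μ ∧ μ ≤ 1 ∧ μ ≤ 2 * Real.sqrt (β * (1 - β)) ∧
      ∫ y, (Real.sqrt (1 - (1 - 2 * y) ^ 2) - μ) * tilt l β y ∂unitMeasure = 0 := by
  have hZ := integral_tilt_pos l β
  have hw := continuous_tilt l β
  set Z := ∫ y, tilt l β y ∂unitMeasure with hZdef
  have hle : ∫ y, Real.sqrt (1 - (1 - 2 * y) ^ 2) * tilt l β y ∂unitMeasure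
      ≤ 2 * Real.sqrt (β * (1 - β)) * Z := by
    -- The slope term of the tangent integrates to zero because the tilted mean is `β`.
    have : ∫ y, (2 * Real.sqrt (β * (1 - β)) * tilt l β y
        + (1 - 2 * β) / Real.sqrt (β * (1 - β)) * ((y - β) * tilt l β y)) ∂unitMeasure
        = 2 * Real.sqrt (β * (1 - β)) * Z := by
      rw [integral_add (integrable_unitMeasure (by fun_prop)) (integrable_unitMeasure
        (by fun_prop)), integral_const_mul, integral_const_mul, hl, mul_zero, add_zero]
    rw [← this]
    refine integral_mono_ae (integrable_unitMeasure (by fun_prop))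
      (integrable_unitMeasure (by fun_prop)) ?_
    filter_upwards [ae_mem_unitMeasure] with y hy
    have := mul_le_mul_of_nonneg_right (sqrt_le_tangent hβ₀ hβ₁ hy) (tilt_pos l β y).le
    linarith
  have hle1 : 2 * Real.sqrt (β * (1 - β)) ≤ 1 := by
    have : Real.sqrt (β * (1 - β)) ≤ 1 / 2 :=
      Real.sqrt_le_iff.2 ⟨by norm_num, by nlinarith [sq_nonneg (2 * β - 1)]⟩
    linarith
  refine ⟨(∫ y, Real.sqrt (1 - (1 - 2 * y) ^ 2) * tilt l β y ∂unitMeasure) / Z,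
    div_nonneg (integral_nonneg fun y => mul_nonneg (Real.sqrt_nonneg _) (tilt_pos l β y).le) hZ.le,
    ((div_le_iff₀ hZ).2 hle).trans hle1, (div_le_iff₀ hZ).2 hle, ?_⟩
  simp only [sub_mul]
  rw [integral_sub (integrable_unitMeasure (by fun_prop)) (integrable_unitMeasure
    (by fun_prop)), integral_const_mul, div_mul_cancel₀ _ hZ.ne', sub_self]

/-- From `1 - 2β = (a₂ - a₁) / (c (t₂ - t₁))` one gets `4β(1 - β) = 1 - (1 - 2β)²`; this identifies
the Jensen bound with the exponent of the theorem. -/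
theorem sqrt_interval_eq {c t₁ t₂ a₁ a₂ : ℝ} (hc : 0 < c) (ht : t₁ < t₂) :
    Real.sqrt (c ^ 2 * (t₂ - t₁) ^ 2 - (a₂ - a₁) ^ 2)
      = c * (t₂ - t₁) *
        (2 * Real.sqrt (beta c t₁ t₂ a₁ a₂ * (1 - beta c t₁ t₂ a₁ a₂))) := by
  have hT : 0 < t₂ - t₁ := sub_pos.2 ht
  rw [← mul_assoc, ← Real.sqrt_sq (show 0 ≤ c * (t₂ - t₁) * 2 by positivity),
    ← Real.sqrt_mul (sq_nonneg _)]
  congr 1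
  unfold beta
  field_simp
  ring

end RelBrownian

theorem theorem2p1 (A m c t₁ t₂ a₁ a₂ : ℝ) (hA : 0 < A) (hm : 0 ≤ m) (hc : 0 < c)
    (ht₁ : 0 < t₁) (ht : t₁ < t₂)
    (hβ₀ : 0 < RelBrownian.beta c t₁ t₂ a₁ a₂) (hβ₁ : RelBrownian.beta c t₁ t₂ a₁ a₂ < 1) :
    ∃ L : ℝ, Tendsto (fun N : ℕ => RelBrownian.approx A m c t₁ t₂ a₁ a₂ N) atTop (𝓝 L) ∧
      A ≤ L ∧
      L ≤ A * Real.exp (m * c * Real.sqrt (c ^ 2 * (t₂ - t₁) ^ 2 - (a₂ - a₁) ^ 2)) := by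
  obtain ⟨l, hl⟩ := RelBrownian.exists_tilt hβ₀ hβ₁
  obtain ⟨μ, hμ0, hμ1, hμ2, hμ⟩ := RelBrownian.exists_tilted_mean hβ₀ hβ₁ hl
  have hT : 0 < t₂ - t₁ := sub_pos.2 ht
  have hκ : 0 ≤ m * c ^ 2 * (t₂ - t₁) := by positivity
  refine ⟨A * Real.exp (m * c ^ 2 * (t₂ - t₁) * μ), ?_, ?_, ?_⟩
  · rw [← tendsto_add_atTop_iff_nat 1]
    simp only [RelBrownian.approx_succ A m hc ht]
    -- `Real.sqrt` vanishes on negative numbers, so the bounds `0 ≤ f ≤ 1` hold on all of `ℝ`.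
    exact (RelBrownian.tendsto_average_exp hβ₀ hβ₁ hκ hl
      (f := fun y => Real.sqrt (1 - (1 - 2 * y) ^ 2)) (by fun_prop) (fun y => Real.sqrt_nonneg _)
      (fun y => Real.sqrt_le_one.2 (by nlinarith [sq_nonneg (1 - 2 * y)])) hμ0 hμ1 hμ).const_mul A
  · exact le_mul_of_one_le_right hA.le (Real.one_le_exp (mul_nonneg hκ hμ0))
  · rw [RelBrownian.sqrt_interval_eq hc ht]
    refine mul_le_mul_of_nonneg_left (Real.exp_le_exp.2 ?_) hA.le
    calc m * c ^ 2 * (t₂ - t₁) * μ ≤ m * c ^ 2 * (t₂ - t₁) * _ :=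
          mul_le_mul_of_nonneg_left hμ2 hκ
      _ = _ := by ring
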